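/- **Model.** An additive network is a finite connected simple graph $G=(V,E)$ with $n=|V|\ge 3$ vertices and diameter $D$. Time is divided into synchronous rounds. In each round every vertex tosses private fair coins (all tosses are independent), transmits a string of $B$ bits (a silent vertex transmits the all-zero string), and receives the bitwise XOR of the strings transmitted by its neighbours; radios are full-duplex, i.e. a vertex receives also while it transmits. All vertices run the same program. A vertex $v$ initially knows only a common number $N$ with $n\le N\le n^{b}$, its own identifier $\mathrm{id}_v\in\{1,\dots,n^{a}\}$ (identifiers are pairwise distinct), and its own input $x_v\in\{1,\dots,n^{k}\}$; the topology of $G$, $n$ and $D$ are unknown. Local computation is free. A vertex terminates by fixing an output, after which it stays silent. **Theorem.** There is an absolute constant $p$ such that for all constants $a,b,k,c\in\mathbb N$ there are a randomized distributed algorithm and constants $K,C$, depending only on $a,b,k,c$, such that the algorithm uses messages of $B\le K(\log N)^{p}=O(\mathrm{poly}\log n)$ bits for every $N \ge 2$ and, on every such network, for all admissible $N$, identifiers and inputs, with probability at least $1-1/n^{c}$ all vertices have terminated with output exactly $\max_{v\in V}x_v$ within $$C\cdot D\cdot\frac{\log n}{\log\log n}$$ rounds. -/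

import Mathlib

open MeasureTheory

namespace AdditiveNetwork

/-- A message of `B` bits. Addition in `Fin B → ZMod 2` is bitwise XOR, and the all-zero message
is what a silent vertex transmits. -/
abbrev Message (B : ℕ) : Type := Fin B → ZMod 2

/-- The local program run by every vertex of an additive network (synchronous, full-duplex,
randomized). It starts from the vertex's own identifier and input only. In each round a vertex
draws `coinBits` fresh private fair coins, transmits a message of `bits` bits, receives the XOR of
the messages of its neighbours, and updates its state. A vertex whose state has an `output` has
terminated. Local computation is not charged. -/
structure Protocol where
  /-- length of a message -/
  bits : ℕ
  /-- number of fair coins that a vertex may toss in one round -/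
  coinBits : ℕ
  /-- local states -/
  State : Type
  /-- initial state, from identifier and input -/
  initial : ℕ → ℕ → State
  /-- message transmitted in a round, from the current state and the coins of the round -/
  transmit : State → (Fin coinBits → Bool) → Message bits
  /-- state after a round, from the current state, the coins of the round, and the received word -/
  update : State → (Fin coinBits → Bool) → Message bits → State
  /-- `some y` if the vertex has terminated with result `y`, and `none` if it is still running -/
  output : State → Option ℕ

namespace Protocol

variable (P : Protocol)

/-- All coin tosses of an execution, indexed by round, vertex, and position within the round. -/
abbrev Coins (V : Type*) : Type _ := ℕ × V × Fin P.coinBits → Bool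

/-- The law of the coin tosses: independent and fair. -/
noncomputable def coinLaw (V : Type*) : Measure (P.Coins V) :=
  Measure.infinitePi fun _ => (PMF.uniformOfFintype Bool).toMeasure

instance (V : Type*) : IsProbabilityMeasure (P.coinLaw V) := by
  unfold coinLaw; infer_instance

variable {V : Type*} [Fintype V]

/-- What a vertex in state `s` sends: its message while it is running, silence once it has
terminated. -/
def sent (s : P.State) (r : Fin P.coinBits → Bool) : Message P.bits :=
  if (P.output s).isSome then 0 else P.transmit s r

/-- The state after a round; a vertex that has terminated never changes its state again. -/
def next (s : P.State) (r : Fin P.coinBits → Bool) (y : Message P.bits) : P.State :=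
  if (P.output s).isSome then s else P.update s r y

/-- The local state of every vertex after `t` rounds on the graph `G`, with identifiers `ident`,
inputs `x` and coins `ω`. The received word of `v` is the XOR of what its neighbours send. -/
def stateAfter (G : SimpleGraph V) [DecidableRel G.Adj] (ident x : V → ℕ) (ω : P.Coins V) :
    ℕ → V → P.State
  | 0, v => P.initial (ident v) (x v)
  | t + 1, v =>
      P.next (stateAfter G ident x ω t v) (fun i => ω (t, v, i))
        (∑ u ∈ G.neighborFinset v,
          P.sent (stateAfter G ident x ω t u) (fun i => ω (t, u, i)))

/-- Within at most `T` rounds every vertex has terminated, with result `y`. -/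
def ComputesWithin (G : SimpleGraph V) [DecidableRel G.Adj] (ident x : V → ℕ) (ω : P.Coins V)
    (y : ℕ) (T : ℝ) : Prop :=
  ∃ t : ℕ, (t : ℝ) ≤ T ∧ ∀ v : V, P.output (P.stateAfter G ident x ω t v) = some y

end Protocol

end AdditiveNetwork

/-! XOR channels can compute neighbourhood maxima over a small alphabet with high probability. A
message has one block per value, and a vertex fills the block of its value with random coins. A
block that no neighbour uses stays zero, and a used one cancels with probability at most `2⁻ˢ`
(`measure_cancel_le`, `decode_sum_encode`). A union bound (`MaxProgram.le_coinLaw_stateAfter_eq`)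
then reduces the theorem to a deterministic program.

Polylogarithmic messages allow an alphabet of size about `log N`, so a key polynomial in `N` has
`O(log n / log log n)` digits. The largest key is found digit by digit, most significant first, by
floods of radius `R` among the keys that match the digits found so far. The diameter being unknown,
`R` doubles, at a geometric total cost. What remains is to detect, unanimously, that `R` was too
small.

A vertex raises an alarm when its maxima over radii `R` and `R + 1` differ, and alarms spread as the
top value. Keys contain the identifiers, hence are distinct, and end with three zero digits. If a
vertex `v` ends without alarm, then no vertex within `3 * R + 1` of `v` has an alarm when the zeros
begin. On that ball the accumulated digits agree, and every vertex within `2 * R + 1` of `v` has a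
key with these digits within distance `R`. Distinctness makes the holder unique, so distance `2 * R
+ 1` from `v` never occurs and the ball is the whole graph (`dist_le_of_ball`). The zero digits
cause no new alarm, so nobody has one (`phaseStart_ne_top_of_exists`). Hence all vertices restart
together or all stop together, and in the latter case the digits are those of the maximum
(`phaseStart_snd_eq_of_forall_ne_top`). -/

namespace AdditiveNetwork

/-! ### Cancellation of fair coins -/

/-- A Boolean as an element of `ZMod 2`. -/
def bit (x : Bool) : ZMod 2 := if x then 1 else 0

theorem bit_xor (x y : Bool) : bit (xor x y) = bit x + bit y := by
  cases x <;> cases y <;> decide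

theorem bit_injective : Function.Injective bit := by
  intro x y; cases x <;> cases y <;> decide

/-- Flipping a fixed set of fair coins preserves their law. -/
theorem measurePreserving_xor {ι : Type*} (z : ι → Bool) :
    MeasurePreserving (fun (ω : ι → Bool) i => xor (z i) (ω i))
      (Measure.infinitePi fun _ => (PMF.uniformOfFintype Bool).toMeasure)
      (Measure.infinitePi fun _ => (PMF.uniformOfFintype Bool).toMeasure) := by
  refine ⟨by fun_prop, ?_⟩
  have h := Measure.infinitePi_map_pi (ι := ι)
    (μ := fun _ => (PMF.uniformOfFintype Bool).toMeasure) (f := fun i (b : Bool) => xor (z i) b)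
    (fun i => measurable_of_countable _)
  rw [h]
  congr 1
  ext1 i
  ext s hs
  classical
  rw [Measure.map_apply (measurable_of_countable _) hs,
    PMF.toMeasure_uniformOfFintype_apply _ (MeasurableSet.of_discrete),
    PMF.toMeasure_uniformOfFintype_apply _ hs]
  congr 2
  refine Fintype.card_congr (Equiv.subtypeEquiv (Equiv.mk (xor (z i)) (xor (z i)) ?_ ?_) ?_)
  · intro x; simp
  · intro x; simp
  · intro x; rfl

/-- A set of coin sequences that depends on finitely many coins is measurable. -/
theorem measurableSet_of_finite_dependence {ι : Type*} (I : Finset ι) (A : Set (ι → Bool))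
    (h : ∀ ω ω' : ι → Bool, (∀ i ∈ I, ω i = ω' i) → ω ∈ A → ω' ∈ A) : MeasurableSet A := by
  have hA : A = I.restrict ⁻¹' (I.restrict '' A) := by
    refine Set.Subset.antisymm (Set.subset_preimage_image _ _) ?_
    rintro ω' ⟨ω, hω, he⟩
    refine h ω ω' (fun i hi => ?_) hω
    exact congrFun he ⟨i, hi⟩
  rw [hA]
  exact Finset.measurable_restrict I (Set.toFinite _).measurableSet

/-- If `W` is a set of vertices containing `u` that is determined by the coins tossed before round
`t`, then the coin strings of round `t` of the vertices in `W` cancel with probability at most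
`2⁻ᵐ`. -/
theorem measure_cancel_le {V : Type*} [Fintype V] {m : ℕ}
    (W : (ℕ × V × Fin m → Bool) → Finset V) (t : ℕ) (u : V)
    (hW : ∀ ω ω' : ℕ × V × Fin m → Bool,
      (∀ t' < t, ∀ v i, ω (t', v, i) = ω' (t', v, i)) → W ω = W ω')
    (hu : ∀ ω, u ∈ W ω) :
    (Measure.infinitePi fun _ : ℕ × V × Fin m => (PMF.uniformOfFintype Bool).toMeasure)
      {ω | ∀ i, ∑ w ∈ W ω, bit (ω (t, w, i)) = 0} ≤ (2 ^ m : ENNReal)⁻¹ := by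
  classical
  set μ := Measure.infinitePi fun _ : ℕ × V × Fin m => (PMF.uniformOfFintype Bool).toMeasure
  set A : Set (ℕ × V × Fin m → Bool) := {ω | ∀ i, ∑ w ∈ W ω, bit (ω (t, w, i)) = 0} with hAdef
  have hA : MeasurableSet A := by
    refine measurableSet_of_finite_dependence
      (Finset.range (t + 1) ×ˢ (Finset.univ : Finset (V × Fin m))) A ?_
    intro ω ω' h hω i
    have h' : ∀ t' ≤ t, ∀ v i, ω (t', v, i) = ω' (t', v, i) := fun t' ht' v i =>
      h _ (by simp; omega)
    rw [← hW ω ω' fun t' ht' => h' t' ht'.le, ← hω i]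
    exact Finset.sum_congr rfl fun w _ => by rw [h' t le_rfl]
  -- Flipping the round-`t` coins of `u` by a pattern `z` preserves the law and does not affect `W`.
  -- The `2 ^ m` preimages of `A` under these flips are disjoint and equally likely.
  let Z : (Fin m → Bool) → ℕ × V × Fin m → Bool :=
    fun z p => if p.1 = t ∧ p.2.1 = u then z p.2.2 else false
  let φ : (Fin m → Bool) → (ℕ × V × Fin m → Bool) → (ℕ × V × Fin m → Bool) :=
    fun z ω p => xor (Z z p) (ω p)
  have hφ : ∀ z, MeasurePreserving (φ z) μ μ := fun z => measurePreserving_xor (Z z)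
  have key : ∀ z ω, φ z ω ∈ A → ∀ i, bit (z i) = - ∑ w ∈ W ω, bit (ω (t, w, i)) := by
    intro z ω h i
    have h1 := h i
    rw [hW (φ z ω) ω] at h1
    · have h2 : ∀ w, bit (φ z ω (t, w, i)) = (if w = u then bit (z i) else 0)
          + bit (ω (t, w, i)) := by
        intro w
        simp only [φ, Z, bit_xor]
        by_cases hw : w = u
        · simp [hw]
        · simp [hw, bit]
      simp only [h2, Finset.sum_add_distrib, Finset.sum_ite_eq', hu ω, if_true] at h1
      exact eq_neg_of_add_eq_zero_left h1
    · intro t' ht' v i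
      simp [φ, Z, ht'.ne]
  have hsum := sum_measure_le_measure_univ (μ := μ) (s := (Finset.univ : Finset (Fin m → Bool)))
    (t := fun z => φ z ⁻¹' A) (fun z _ => ((hφ z).measurable hA).nullMeasurableSet) (by
      intro z _ z' _ hne
      refine Disjoint.aedisjoint (Set.disjoint_left.2 fun ω h h' => hne ?_)
      funext i
      exact bit_injective ((key z ω h i).trans (key z' ω h' i).symm))
  simp only [fun z => (hφ z).measure_preimage hA.nullMeasurableSet, Finset.sum_const,
    Finset.card_univ, Fintype.card_fun, Fintype.card_bool, Fintype.card_fin, nsmul_eq_mul] at hsum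
  have huniv : μ Set.univ = 1 := measure_univ
  rw [huniv] at hsum
  rw [ENNReal.le_inv_iff_mul_le, mul_comm]
  exact_mod_cast hsum

/-! ### Programs in which a vertex hears the maximum of its neighbours' values -/

/-- A deterministic local program in which, in every round, a vertex exposes a value and learns the
maximum of the values exposed by its neighbours. -/
structure MaxProgram (β : ℕ) where
  State : Type
  initial : ℕ → ℕ → State
  value : State → Fin (β + 1)
  update : State → Fin (β + 1) → State
  output : State → Option ℕ

/-- A value, as the coin string `r` in the block of that value. -/
def encode {β s : ℕ} (c : Fin (β + 1)) (r : Fin s → Bool) : Message ((β + 1) * s) :=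
  fun k => if (finProdFinEquiv.symm k).1 = c then bit (r (finProdFinEquiv.symm k).2) else 0

/-- The largest value whose block is nonzero. -/
noncomputable def decode {β s : ℕ} (y : Message ((β + 1) * s)) : Fin (β + 1) :=
  (Finset.univ.filter fun c => ∃ i : Fin s, y (finProdFinEquiv (c, i)) ≠ 0).sup id

theorem sum_encode_apply {V : Type*} {β s : ℕ} (S : Finset V) (g : V → Fin (β + 1))
    (r : V → Fin s → Bool) (c : Fin (β + 1)) (i : Fin s) :
    (∑ u ∈ S, encode (g u) (r u)) (finProdFinEquiv (c, i)) =
      ∑ u ∈ S with g u = c, bit (r u i) := by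
  simp only [encode, Finset.sum_apply, Equiv.symm_apply_apply, Finset.sum_filter]
  exact Finset.sum_congr rfl fun u _ => by simp only [eq_comm]

/-- Blocks of absent values are always zero, so cancellation in the block of a value that is present
is the only possible error. -/
theorem decode_sum_encode {V : Type*} {β s : ℕ} (S : Finset V) (g : V → Fin (β + 1))
    (r : V → Fin s → Bool)
    (h : ∀ u ∈ S, ¬ ∀ i, ∑ w ∈ S with g w = g u, bit (r w i) = 0) :
    decode (∑ u ∈ S, encode (g u) (r u)) = S.sup g := by
  unfold decode
  simp only [sum_encode_apply]
  apply le_antisymm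
  · refine Finset.sup_le fun c hc => ?_
    obtain ⟨i, hi⟩ := (Finset.mem_filter.1 hc).2
    obtain ⟨u, hu, -⟩ := Finset.exists_ne_zero_of_sum_ne_zero hi
    rw [Finset.mem_filter] at hu
    rw [← hu.2]
    exact Finset.le_sup (f := g) hu.1
  · refine Finset.sup_le fun u hu => ?_
    refine Finset.le_sup (f := id) (Finset.mem_filter.2 ⟨Finset.mem_univ _, ?_⟩)
    have := h u hu
    push Not at this
    exact this

namespace Protocol

variable (P : Protocol) {V : Type*} [Fintype V]

/-- Makes the set of neighbours exposing a given value in round `t` independent of the coins of that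
round, as `measure_cancel_le` requires. -/
theorem stateAfter_congr (G : SimpleGraph V) [DecidableRel G.Adj] (ident x : V → ℕ)
    (ω ω' : P.Coins V) (t : ℕ)
    (h : ∀ t' < t, ∀ v i, ω (t', v, i) = ω' (t', v, i)) :
    P.stateAfter G ident x ω t = P.stateAfter G ident x ω' t := by
  induction t with
  | zero => rfl
  | succ t ih =>
    funext v
    simp only [stateAfter]
    rw [ih fun t' ht' => h t' (by omega)]
    simp only [h t (Nat.lt_succ_self t)]

end Protocol

/-! ### Simulating a deterministic program by random strings -/

namespace MaxProgram

variable {β : ℕ} (A : MaxProgram β) {V : Type*} [Fintype V]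

/-- One round of a `MaxProgram`. -/
noncomputable def round (G : SimpleGraph V) [DecidableRel G.Adj] (σ : V → A.State) : V → A.State :=
  fun v => A.update (σ v) ((G.neighborFinset v).sup fun u => A.value (σ u))

/-- The randomized implementation in an additive network, with `s` coins per round. -/
noncomputable def toProtocol (s : ℕ) : Protocol where
  bits := (β + 1) * s
  coinBits := s
  State := A.State
  initial := A.initial
  transmit σ r := encode (A.value σ) r
  update σ _ y := A.update σ (decode y)
  output := A.output

/-- The configuration `σ` reaches `τ` after `t` rounds, no vertex having an output before. -/
def Reaches (G : SimpleGraph V) [DecidableRel G.Adj] (t : ℕ) (σ τ : V → A.State) : Prop :=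
  (A.round G)^[t] σ = τ ∧ ∀ t' < t, ∀ v, A.output ((A.round G)^[t'] σ v) = none

variable {A} {G : SimpleGraph V} [DecidableRel G.Adj]

theorem Reaches.refl (σ : V → A.State) : A.Reaches G 0 σ σ := ⟨rfl, by simp⟩

theorem Reaches.trans {t t' : ℕ} {σ τ υ : V → A.State} (h : A.Reaches G t σ τ)
    (h' : A.Reaches G t' τ υ) : A.Reaches G (t + t') σ υ := by
  refine ⟨?_, fun k hk v => ?_⟩
  · rw [add_comm, Function.iterate_add_apply, h.1, h'.1]
  · rcases lt_or_ge k t with hkt | hkt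
    · exact h.2 k hkt v
    · obtain ⟨j, rfl⟩ := Nat.exists_eq_add_of_le hkt
      rw [add_comm t j, Function.iterate_add_apply, h.1]
      exact h'.2 j (by omega) v

theorem Reaches.single {σ τ : V → A.State} (h : ∀ v, A.output (σ v) = none)
    (hτ : A.round G σ = τ) : A.Reaches G 1 σ τ := by
  refine ⟨hτ, fun t' ht' v => ?_⟩
  obtain rfl : t' = 0 := by omega
  exact h v

theorem stateAfter_toProtocol (s : ℕ) (ident x : V → ℕ) (ω : (A.toProtocol s).Coins V) (T : ℕ)
    (hT : ∀ t < T, ∀ v,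
      A.output ((A.round G)^[t] (fun v => A.initial (ident v) (x v)) v) = none)
    (hω : ∀ t < T, ∀ v, ∀ u ∈ G.neighborFinset v,
      ¬ ∀ i : Fin s, ∑ w ∈ G.neighborFinset v with
          A.value ((A.toProtocol s).stateAfter G ident x ω t w) =
            A.value ((A.toProtocol s).stateAfter G ident x ω t u), bit (ω (t, w, i)) = 0) :
    ∀ t ≤ T, (A.toProtocol s).stateAfter G ident x ω t =
      (A.round G)^[t] (fun v => A.initial (ident v) (x v)) := by
  intro t
  induction t with
  | zero => intro _; rfl
  | succ t ih =>
    intro ht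
    have ih := ih (by omega)
    have h0 := hT t ht
    rw [← ih] at h0
    rw [Function.iterate_succ_apply', ← ih]
    funext v
    simp only [Protocol.stateAfter, Protocol.next, Protocol.sent]
    have h1 : ∀ v, ((A.toProtocol s).output
        ((A.toProtocol s).stateAfter G ident x ω t v)).isSome = false := by
      intro v
      change (A.output _).isSome = false
      rw [h0 v]; rfl
    simp only [h1, Bool.false_eq_true, if_false]
    change A.update _ (decode (∑ u ∈ G.neighborFinset v,
      encode (A.value ((A.toProtocol s).stateAfter G ident x ω t u)) fun i : Fin s => ω (t, u, i)))
      = A.update _ _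
    rw [decode_sum_encode _ _ _ fun u hu => hω t ht v u hu]

/-- The implementation follows the deterministic execution for `T` rounds, up to a failure
probability of `2⁻ˢ` for each round and each pair of vertices. -/
theorem le_coinLaw_stateAfter_eq (s : ℕ) (ident x : V → ℕ) (T : ℕ)
    (hT : ∀ t < T, ∀ v,
      A.output ((A.round G)^[t] (fun v => A.initial (ident v) (x v)) v) = none) :
    1 - (T * Fintype.card V ^ 2 : ℝ) / 2 ^ s ≤ ((A.toProtocol s).coinLaw V).real
      {ω | (A.toProtocol s).stateAfter G ident x ω T =
        (A.round G)^[T] (fun v => A.initial (ident v) (x v))} := by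
  classical
  set μ := (A.toProtocol s).coinLaw V with hμ
  let Bad : ℕ → V → V → Set ((A.toProtocol s).Coins V) := fun t v u =>
    {ω | ∀ i : Fin s, ∑ w ∈ G.neighborFinset v with
          A.value ((A.toProtocol s).stateAfter G ident x ω t w) =
            A.value ((A.toProtocol s).stateAfter G ident x ω t u), bit (ω (t, w, i)) = 0}
  have hBad : ∀ t v u, u ∈ G.neighborFinset v → μ (Bad t v u) ≤ (2 ^ s : ENNReal)⁻¹ := by
    intro t v u hu
    refine measure_cancel_le (m := s) (fun ω => (G.neighborFinset v).filter fun w =>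
      A.value ((A.toProtocol s).stateAfter G ident x ω t w) =
        A.value ((A.toProtocol s).stateAfter G ident x ω t u)) t u ?_ ?_
    · intro ω ω' h
      simp only [(A.toProtocol s).stateAfter_congr G ident x ω ω' t h]
    · intro ω
      simp only [Finset.mem_filter, and_true]
      exact hu
  let I : Finset (ℕ × V × V) :=
    (Finset.range T ×ˢ (Finset.univ : Finset (V × V))).filter fun p => G.Adj p.2.1 p.2.2
  let U : Set ((A.toProtocol s).Coins V) := ⋃ p ∈ I, Bad p.1 p.2.1 p.2.2
  have hU : μ U ≤ (T * Fintype.card V ^ 2 : ℕ) * (2 ^ s : ENNReal)⁻¹ := by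
    refine (measure_biUnion_finset_le _ _).trans ?_
    refine (Finset.sum_le_card_nsmul _ _ (2 ^ s : ENNReal)⁻¹ ?_).trans ?_
    · intro p hp
      exact hBad _ _ _ (by simpa [I] using (Finset.mem_filter.1 hp).2)
    · rw [nsmul_eq_mul]
      gcongr
      refine (Finset.card_filter_le _ _).trans ?_
      simp [Finset.card_product, sq]
  have hsub : Uᶜ ⊆ {ω | (A.toProtocol s).stateAfter G ident x ω T =
        (A.round G)^[T] (fun v => A.initial (ident v) (x v))} := by
    intro ω hω
    refine stateAfter_toProtocol s ident x ω T hT (fun t ht v u hu hbad => hω ?_) T le_rfl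
    refine Set.mem_biUnion (x := (t, v, u)) ?_ hbad
    exact Finset.mem_coe.2 (Finset.mem_filter.2 ⟨by simpa using ht, by simpa using hu⟩)
  have hUr : μ.real U ≤ (T * Fintype.card V ^ 2 : ℝ) / 2 ^ s := by
    refine ENNReal.toReal_le_of_le_ofReal (by positivity) (hU.trans (le_of_eq ?_))
    rw [ENNReal.ofReal_div_of_pos (by positivity), ENNReal.div_eq_inv_mul, mul_comm]
    congr 1
    · rw [ENNReal.ofReal_pow (by norm_num)]; norm_num
    · exact_mod_cast (ENNReal.ofReal_natCast (T * Fintype.card V ^ 2)).symm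
  -- Subadditivity suffices here, so measurability of `U` is not needed.
  have h1 : (1 : ℝ) ≤ μ.real U + μ.real Uᶜ := by
    have := measureReal_union_le (μ := μ) U Uᶜ
    rwa [Set.union_compl_self, probReal_univ] at this
  have h2 := measureReal_mono (μ := μ) hsub
  linarith

end MaxProgram

/-! ### Flooding the maximum -/

section Flood

variable {V : Type*} {G : SimpleGraph V}

theorem dist_le_one_iff (hG : G.Connected) {u v : V} : G.dist u v ≤ 1 ↔ u = v ∨ G.Adj u v := by
  constructor
  · intro h
    rcases Nat.le_one_iff_eq_zero_or_eq_one.1 h with h | h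
    · exact Or.inl (hG.dist_eq_zero_iff.1 h)
    · exact Or.inr (SimpleGraph.dist_eq_one_iff_adj.1 h)
  · rintro (rfl | h)
    · simp
    · exact (SimpleGraph.dist_eq_one_iff_adj.2 h).le

theorem exists_dist_le_and_dist_le (hG : G.Connected) {u v : V} {a b : ℕ}
    (h : G.dist u v ≤ a + b) : ∃ w, G.dist u w ≤ a ∧ G.dist w v ≤ b := by
  obtain ⟨p, hp⟩ := hG.exists_walk_length_eq_dist u v
  refine ⟨p.getVert a, (SimpleGraph.dist_le (p.take a)).trans ?_,
    (SimpleGraph.dist_le (p.drop a)).trans ?_⟩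
  · rw [SimpleGraph.Walk.take_length]; exact min_le_left _ _
  · rw [SimpleGraph.Walk.drop_length]; omega

variable [Fintype V] (G) [DecidableRel G.Adj] {β : ℕ}

/-- Every vertex replaces its value by the maximum over its closed neighbourhood. -/
noncomputable def flood (f : V → Fin (β + 1)) : V → Fin (β + 1) :=
  fun v => max (f v) ((G.neighborFinset v).sup f)

variable {G}

theorem le_flood {f : V → Fin (β + 1)} {u v : V} (h : u = v ∨ G.Adj u v) :
    f u ≤ flood G f v := by
  rcases h with rfl | h
  · exact le_max_left _ _
  · exact le_max_of_le_right (Finset.le_sup (f := f) (by simpa using h.symm))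

/-- Together with `exists_iterate_flood_eq` this identifies `r` floods with the maximum over the
ball of radius `r`. -/
theorem le_iterate_flood (hG : G.Connected) (f : V → Fin (β + 1)) {u v : V} {r : ℕ}
    (h : G.dist u v ≤ r) : f u ≤ (flood G)^[r] f v := by
  induction r generalizing v with
  | zero =>
    obtain rfl := hG.dist_eq_zero_iff.1 (Nat.le_zero.1 h)
    exact le_rfl
  | succ r ih =>
    obtain ⟨w, h1, h2⟩ := exists_dist_le_and_dist_le hG h
    rw [Function.iterate_succ_apply']
    exact (ih h1).trans (le_flood ((dist_le_one_iff hG).1 h2))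

theorem exists_iterate_flood_eq (hG : G.Connected) (f : V → Fin (β + 1)) (v : V) (r : ℕ) :
    ∃ u, G.dist u v ≤ r ∧ (flood G)^[r] f v = f u := by
  induction r generalizing v with
  | zero => exact ⟨v, by simp, rfl⟩
  | succ r ih =>
    have : ∃ w, G.dist w v ≤ 1 ∧ (flood G)^[r + 1] f v = (flood G)^[r] f w := by
      rw [Function.iterate_succ_apply']
      rcases (G.neighborFinset v).eq_empty_or_nonempty with he | he
      · exact ⟨v, by simp, by simp [flood, he]⟩
      · obtain ⟨w, hw, hs⟩ := Finset.exists_mem_eq_sup _ he ((flood G)^[r] f)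
        rcases le_total ((flood G)^[r] f v) ((G.neighborFinset v).sup ((flood G)^[r] f)) with h | h
        · refine ⟨w, (dist_le_one_iff hG).2 (Or.inr ?_), ?_⟩
          · exact ((SimpleGraph.mem_neighborFinset _ _ _).1 hw).symm
          · rw [flood, max_eq_right h, hs]
        · exact ⟨v, by simp, by rw [flood, max_eq_left h]⟩
    obtain ⟨w, hw, he⟩ := this
    obtain ⟨u, hu, he'⟩ := ih w
    exact ⟨u, (hG.dist_triangle (v := w)).trans (by omega), he.trans he'⟩

end Flood

/-! ### One attempt to agree on the largest key, with floods of `R` rounds -/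

/-- The `i`-th of `L` digits of `key` to the base `β`, the most significant digit being the
zeroth. -/
def digit (β L key i : ℕ) : Fin (β + 1) := Fin.ofNat (β + 1) (key / β ^ (L - 1 - i) % β)

/-- What a vertex with key `key` floods in phase `i`: its digit, if its first `i` digits form the
number `acc`. -/
def proposal (β L key i acc : ℕ) : Fin (β + 1) :=
  if key / β ^ (L - i) = acc then digit β L key i else 0

/-- The flooded value and the accumulated digits at the start of phase `i + 1`, given the maximum
`a` within distance `R`, and the maximum `b` within distance `R + 1`, in phase `i`. The value `⊤`
is an alarm. -/
def advance (β L key i : ℕ) (a b : Fin (β + 1)) (acc : ℕ) : Fin (β + 1) × ℕ :=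
  if b = a ∧ b ≠ ⊤ then (proposal β L key (i + 1) (acc * β + a), acc * β + a) else (⊤, acc)

/-! ### Arithmetic of digits and prefixes -/

section Digits

variable {β L : ℕ}

theorem val_digit (hβ : 0 < β) (key i : ℕ) :
    (digit β L key i : ℕ) = key / β ^ (L - 1 - i) % β := by
  have := Nat.mod_lt (key / β ^ (L - 1 - i)) hβ
  simp only [digit, Fin.ofNat]
  exact Nat.mod_eq_of_lt (by omega)

theorem digit_ne_top (hβ : 0 < β) (key i : ℕ) : digit β L key i ≠ ⊤ := by
  intro h
  have h1 := val_digit (L := L) hβ key i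
  have := Nat.mod_lt (key / β ^ (L - 1 - i)) hβ
  rw [h, Fin.top_eq_last, Fin.val_last] at h1
  omega

theorem proposal_ne_top (hβ : 0 < β) (key i acc : ℕ) : proposal β L key i acc ≠ ⊤ := by
  unfold proposal
  split_ifs
  · exact digit_ne_top hβ key i
  · rw [Fin.top_eq_last]
    intro h
    have := congrArg Fin.val h
    simp at this
    omega

theorem div_pow_succ (hβ : 0 < β) (key : ℕ) {i : ℕ} (hi : i < L) :
    key / β ^ (L - (i + 1)) = key / β ^ (L - i) * β + digit β L key i := by
  rw [val_digit hβ, show L - i = L - 1 - i + 1 by omega, show L - (i + 1) = L - 1 - i by omega,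
    pow_succ, ← Nat.div_div_eq_div_mul, mul_comm]
  exact (Nat.div_add_mod _ _).symm

theorem proposal_self (key i : ℕ) : proposal β L key i (key / β ^ (L - i)) = digit β L key i := by
  simp [proposal]

/-- Among keys with the same prefix as `M`, a larger next digit would make the key larger than `M`.
-/
theorem proposal_le (hβ : 0 < β) {key M i : ℕ} (hi : i < L) (h : key ≤ M) :
    proposal β L key i (M / β ^ (L - i)) ≤ digit β L M i := by
  unfold proposal
  split_ifs with hp
  · have h1 : key / β ^ (L - (i + 1)) ≤ M / β ^ (L - (i + 1)) := Nat.div_le_div_right h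
    rw [div_pow_succ hβ _ hi, div_pow_succ hβ _ hi, hp] at h1
    exact Fin.le_def.2 (by omega)
  · exact Fin.zero_le _

theorem digit_eq_zero_of_dvd (hβ : 0 < β) {key i l : ℕ} (hi : l ≤ i) (hiL : i < L)
    (h : β ^ (L - l) ∣ key) : digit β L key i = 0 := by
  apply Fin.ext
  rw [val_digit hβ]
  have h1 : β ^ (L - 1 - i) * β ∣ key := by
    rw [← pow_succ]
    exact (pow_dvd_pow β (by omega)).trans h
  obtain ⟨c, rfl⟩ := h1
  rw [mul_assoc, Nat.mul_div_cancel_left _ (pow_pos hβ _)]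
  simp

end Digits

/-! ### Consistency near vertices without alarm -/

section Attempt

variable {V : Type*} [Fintype V] (G : SimpleGraph V) [DecidableRel G.Adj] (β L R : ℕ)
  (key : V → ℕ)

/-- Flooded values and accumulated digits at the start of phase `i`. -/
noncomputable def phaseStart : ℕ → V → Fin (β + 1) × ℕ
  | 0, v => (proposal β L (key v) 0 0, 0)
  | i + 1, v => advance β L (key v) i
      ((flood G)^[R] (fun u => (phaseStart i u).1) v)
      ((flood G)^[R + 1] (fun u => (phaseStart i u).1) v) (phaseStart i v).2

variable {G β L R key}

theorem phaseStart_succ_fst_ne_top_iff (hβ : 0 < β) (i : ℕ) (v : V) :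
    (phaseStart G β L R key (i + 1) v).1 ≠ ⊤ ↔
      (flood G)^[R + 1] (fun u => (phaseStart G β L R key i u).1) v =
        (flood G)^[R] (fun u => (phaseStart G β L R key i u).1) v ∧
      (flood G)^[R + 1] (fun u => (phaseStart G β L R key i u).1) v ≠ ⊤ := by
  rw [phaseStart, advance]
  split_ifs with h
  · simp only [ne_eq, proposal_ne_top hβ, not_false_eq_true, true_iff]
    exact h
  · simp only [ne_eq, not_true_eq_false, false_iff]
    exact h

theorem phaseStart_succ_of_ne_top (hβ : 0 < β) {i : ℕ} {v : V}
    (h : (phaseStart G β L R key (i + 1) v).1 ≠ ⊤) :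
    phaseStart G β L R key (i + 1) v =
      (proposal β L (key v) (i + 1) ((phaseStart G β L R key i v).2 * β +
          (flood G)^[R] (fun u => (phaseStart G β L R key i u).1) v),
        (phaseStart G β L R key i v).2 * β +
          (flood G)^[R] (fun u => (phaseStart G β L R key i u).1) v) := by
  rw [phaseStart_succ_fst_ne_top_iff hβ] at h
  rw [phaseStart, advance, if_pos h]

theorem phaseStart_fst_of_ne_top (hβ : 0 < β) {i : ℕ} {v : V}
    (h : (phaseStart G β L R key i v).1 ≠ ⊤) :
    (phaseStart G β L R key i v).1 =
      proposal β L (key v) i (phaseStart G β L R key i v).2 := by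
  cases i with
  | zero => rfl
  | succ i => rw [phaseStart_succ_of_ne_top hβ h]

/-- An alarm spreads by `R + 1` hops in each phase. -/
theorem phaseStart_ne_top_of_dist_le (hG : G.Connected) (hβ : 0 < β) {i k : ℕ} {u v : V}
    (h : (phaseStart G β L R key (i + k) v).1 ≠ ⊤) (hd : G.dist u v ≤ k * (R + 1)) :
    (phaseStart G β L R key i u).1 ≠ ⊤ := by
  induction k generalizing v with
  | zero =>
    obtain rfl := hG.dist_eq_zero_iff.1 (Nat.le_zero.1 (by simpa using hd))
    exact h
  | succ k ih =>
    obtain ⟨w, h1, h2⟩ := exists_dist_le_and_dist_le hG (a := k * (R + 1)) (b := R + 1)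
      (by rwa [Nat.succ_mul] at hd)
    refine ih (fun hw => ?_) h1
    refine ((phaseStart_succ_fst_ne_top_iff hβ (i + k) v).1 h).2 (top_le_iff.1 ?_)
    rw [← hw]
    exact le_iterate_flood hG (fun u => (phaseStart G β L R key (i + k) u).1) h2

theorem phaseStart_ne_top_of_le (hG : G.Connected) (hβ : 0 < β) {i l : ℕ} (hi : i ≤ l) {v : V}
    (h : (phaseStart G β L R key l v).1 ≠ ⊤) : (phaseStart G β L R key i v).1 ≠ ⊤ := by
  obtain ⟨k, rfl⟩ := Nat.exists_eq_add_of_le hi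
  exact phaseStart_ne_top_of_dist_le hG hβ h (by simp)

/-- The `R`-ball of `u` lies in the `(R + 1)`-ball of `w`, over which `w`, having no alarm, sees the
same maximum as over its own `R`-ball. -/
theorem iterate_flood_phaseStart_le_of_adj (hβ : 0 < β) {i : ℕ} {u w : V} (huw : G.Adj u w)
    (hw : (phaseStart G β L R key (i + 1) w).1 ≠ ⊤) :
    (flood G)^[R] (fun u => (phaseStart G β L R key i u).1) u ≤
      (flood G)^[R] (fun u => (phaseStart G β L R key i u).1) w := by
  rw [← ((phaseStart_succ_fst_ne_top_iff hβ i w).1 hw).1, Function.iterate_succ_apply']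
  exact le_flood (Or.inr huw)

theorem phaseStart_snd_eq_of_adj (hG : G.Connected) (hβ : 0 < β) {i : ℕ} {u w : V}
    (huw : G.Adj u w) (hu : (phaseStart G β L R key i u).1 ≠ ⊤)
    (hw : (phaseStart G β L R key i w).1 ≠ ⊤) :
    (phaseStart G β L R key i u).2 = (phaseStart G β L R key i w).2 := by
  induction i with
  | zero => rfl
  | succ i ih =>
    rw [phaseStart_succ_of_ne_top hβ hu, phaseStart_succ_of_ne_top hβ hw,
      ih (phaseStart_ne_top_of_le hG hβ (Nat.le_succ i) hu)
        (phaseStart_ne_top_of_le hG hβ (Nat.le_succ i) hw),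
      le_antisymm (iterate_flood_phaseStart_le_of_adj hβ huw hw)
        (iterate_flood_phaseStart_le_of_adj hβ huw.symm hu)]

theorem phaseStart_snd_eq_of_ball (hG : G.Connected) (hβ : 0 < β) {i ρ : ℕ} {v : V}
    (h : ∀ w, G.dist v w ≤ ρ → (phaseStart G β L R key i w).1 ≠ ⊤) {w : V}
    (hw : G.dist v w ≤ ρ) :
    (phaseStart G β L R key i w).2 = (phaseStart G β L R key i v).2 := by
  induction ρ generalizing w with
  | zero => rw [hG.dist_eq_zero_iff.1 (Nat.le_zero.1 hw)]
  | succ ρ ih =>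
    obtain ⟨z, h1, h2⟩ := exists_dist_le_and_dist_le hG hw
    rw [← ih (fun w hw => h w (by omega)) h1]
    rcases (dist_le_one_iff hG).1 h2 with rfl | h2
    · rfl
    · exact (phaseStart_snd_eq_of_adj hG hβ h2 (h z (by omega)) (h w hw)).symm

/-- As long as no vertex near `v` has raised an alarm, a vertex whose key agrees with the
accumulated digits is within distance `R` of every vertex near `v`. -/
theorem exists_key_div_eq (hG : G.Connected) (hβ : 0 < β) (hkey : ∀ v, key v < β ^ L)
    {l ρ : ℕ} (hl : l ≤ L) {v : V}
    (h : ∀ w, G.dist v w ≤ ρ → (phaseStart G β L R key l w).1 ≠ ⊤)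
    {w : V} (hw : G.dist v w + R ≤ ρ) {i : ℕ} (hi : i ≤ l) :
    ∃ u, G.dist u w ≤ R ∧ key u / β ^ (L - i) = (phaseStart G β L R key i v).2 := by
  have hok : ∀ j ≤ l, ∀ w, G.dist v w ≤ ρ → (phaseStart G β L R key j w).1 ≠ ⊤ :=
    fun j hj w hw => phaseStart_ne_top_of_le hG hβ hj (h w hw)
  induction i with
  | zero => exact ⟨w, by simp, by simpa [phaseStart] using Nat.div_eq_of_lt (hkey w)⟩
  | succ i ih =>
    obtain ⟨u', hu', hk'⟩ := ih (by omega)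
    have hball : ∀ u, G.dist u w ≤ R → G.dist v u ≤ ρ := fun u hu =>
      (hG.dist_triangle (v := w)).trans (by rw [SimpleGraph.dist_comm (u := w)]; omega)
    have hprop : ∀ u, G.dist u w ≤ R → (phaseStart G β L R key i u).1 =
        proposal β L (key u) i (phaseStart G β L R key i v).2 := by
      intro u hu
      rw [phaseStart_fst_of_ne_top hβ (hok i (by omega) u (hball u hu)),
        phaseStart_snd_eq_of_ball hG hβ (hok i (by omega)) (hball u hu)]
    obtain ⟨u, hu, he⟩ := exists_iterate_flood_eq hG
      (fun u => (phaseStart G β L R key i u).1) w R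
    have hle := le_iterate_flood hG (fun u => (phaseStart G β L R key i u).1) hu'
    have hacc : (phaseStart G β L R key (i + 1) v).2 = (phaseStart G β L R key i v).2 * β +
        (flood G)^[R] (fun u => (phaseStart G β L R key i u).1) w := by
      rw [← phaseStart_snd_eq_of_ball hG hβ (hok (i + 1) hi) (show G.dist v w ≤ ρ by omega),
        phaseStart_succ_of_ne_top hβ (hok (i + 1) hi w (by omega)),
        phaseStart_snd_eq_of_ball hG hβ (hok i (by omega)) (show G.dist v w ≤ ρ by omega)]
    rw [hacc]
    rw [he] at hle ⊢
    rw [hprop u hu] at hle ⊢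
    rw [hprop u' hu', proposal, if_pos hk'] at hle
    -- If the maximizer `u` still matches the prefix, its digit is the new one. Otherwise the
    -- maximum is the default `0`, so the previous witness `u'` has digit `0` and keeps matching.
    by_cases hk : key u / β ^ (L - i) = (phaseStart G β L R key i v).2
    · exact ⟨u, hu, by rw [div_pow_succ hβ _ (by omega), proposal, if_pos hk, hk]⟩
    · rw [proposal, if_neg hk] at hle ⊢
      exact ⟨u', hu', by rw [div_pow_succ hβ _ (by omega), hk', Fin.le_zero_iff.1 hle]⟩

/-- If no vertex within distance `3 * R + 1` of `v` has raised an alarm by the start of phase `l`,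
and the first `l` digits distinguish all keys, then every vertex is within distance `2 * R`. -/
theorem dist_le_of_ball (hG : G.Connected) (hβ : 0 < β) (hkey : ∀ v, key v < β ^ L)
    {l : ℕ} (hl : l ≤ L) (hinj : Function.Injective fun v => key v / β ^ (L - l)) {v : V}
    (h : ∀ w, G.dist v w ≤ 3 * R + 1 → (phaseStart G β L R key l w).1 ≠ ⊤) (w : V) :
    G.dist v w ≤ 2 * R := by
  -- Along a walk the distance from `v` grows by at most one per step, so it suffices to exclude the
  -- value `2 * R + 1`.
  obtain ⟨p⟩ := hG.preconnected w v
  induction p with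
  | nil => simp
  | @cons w z v hwz p ih =>
    have hz := ih h
    have hw : G.dist v w ≤ 2 * R + 1 := (hG.dist_triangle (v := z)).trans
      (Nat.add_le_add hz ((dist_le_one_iff hG).2 (Or.inr hwz.symm)))
    obtain ⟨u, hu, hku⟩ := exists_key_div_eq hG hβ hkey hl h (w := w) (by omega) le_rfl
    obtain ⟨u', hu', hku'⟩ := exists_key_div_eq hG hβ hkey hl h (w := v) (by simp; omega) le_rfl
    obtain rfl : u = u' := hinj (hku.trans hku'.symm)
    rw [SimpleGraph.dist_comm] at hu'
    exact (hG.dist_triangle (v := u)).trans (by omega)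

variable {M : ℕ}

/-- Without alarms all vertices accumulate the same digits, so it suffices to look at a holder of
`M`. It hears its own proposal whatever `R` is, and no other proposal exceeds it. -/
theorem phaseStart_snd_eq_of_forall_ne_top (hG : G.Connected) (hβ : 0 < β)
    (hM : ∀ v, key v ≤ M) (hM' : ∃ v, key v = M) (hML : M < β ^ L) {i : ℕ} (hi : i ≤ L)
    (h : ∀ w, (phaseStart G β L R key i w).1 ≠ ⊤) (v : V) :
    (phaseStart G β L R key i v).2 = M / β ^ (L - i) := by
  induction i generalizing v with
  | zero => simpa [phaseStart] using (Nat.div_eq_of_lt hML).symm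
  | succ i ih =>
    have hok : ∀ w, (phaseStart G β L R key i w).1 ≠ ⊤ := fun w =>
      phaseStart_ne_top_of_le hG hβ (Nat.le_succ i) (h w)
    have ih := ih (by omega) hok
    have hf : ∀ u, (phaseStart G β L R key i u).1 = proposal β L (key u) i (M / β ^ (L - i)) :=
      fun u => by rw [phaseStart_fst_of_ne_top hβ (hok u), ih]
    obtain ⟨m, rfl⟩ := hM'
    have hvm := phaseStart_snd_eq_of_ball hG hβ (fun w _ => h w) (le_refl (G.dist m v))
    rw [hvm, phaseStart_succ_of_ne_top hβ (h m), ih, div_pow_succ hβ _ (by omega)]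
    dsimp only
    congr 2
    apply le_antisymm
    · obtain ⟨u, -, he⟩ := exists_iterate_flood_eq hG
        (fun u => (phaseStart G β L R key i u).1) m R
      rw [he]
      rw [hf]
      exact proposal_le hβ (by omega) (hM u)
    · refine le_of_eq_of_le ?_ (le_iterate_flood hG
        (fun u => (phaseStart G β L R key i u).1) (u := m) (v := m) (by simp))
      rw [hf, proposal_self]

/-- A phase in which every vertex hears the relevant digit of the largest key raises no alarm. -/
theorem phaseStart_succ_ne_top (hG : G.Connected) (hβ : 0 < β)
    (hM : ∀ v, key v ≤ M) (hM' : ∃ v, key v = M) (hML : M < β ^ L) {i : ℕ} (hi : i < L)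
    (h : ∀ w, (phaseStart G β L R key i w).1 ≠ ⊤)
    (hR : (∀ u v, G.dist u v ≤ R) ∨ digit β L M i = 0) (v : V) :
    (phaseStart G β L R key (i + 1) v).1 ≠ ⊤ := by
  have hf : ∀ u, (phaseStart G β L R key i u).1 = proposal β L (key u) i (M / β ^ (L - i)) :=
    fun u => by rw [phaseStart_fst_of_ne_top hβ (h u),
      phaseStart_snd_eq_of_forall_ne_top hG hβ hM hM' hML hi.le h]
  have hval : ∀ r, R ≤ r →
      (flood G)^[r] (fun u => (phaseStart G β L R key i u).1) v = digit β L M i := by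
    intro r hr
    apply le_antisymm
    · obtain ⟨u, -, he⟩ := exists_iterate_flood_eq hG
        (fun u => (phaseStart G β L R key i u).1) v r
      rw [he]
      rw [hf]
      exact proposal_le hβ hi (hM u)
    · rcases hR with hR | hR
      · obtain ⟨m, rfl⟩ := hM'
        refine le_of_eq_of_le ?_ (le_iterate_flood hG
          (fun u => (phaseStart G β L R key i u).1) ((hR m v).trans hr))
        rw [hf, proposal_self]
      · rw [hR]
        exact Fin.zero_le _
  rw [phaseStart_succ_fst_ne_top_iff hβ, hval R le_rfl, hval (R + 1) (Nat.le_succ R)]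
  exact ⟨rfl, digit_ne_top hβ _ _⟩

/-- If floods reach the whole network, no vertex raises an alarm. -/
theorem phaseStart_ne_top_of_dist_le_radius (hG : G.Connected) (hβ : 0 < β)
    (hM : ∀ v, key v ≤ M) (hM' : ∃ v, key v = M) (hML : M < β ^ L)
    (hR : ∀ u v, G.dist u v ≤ R) {i : ℕ} (hi : i ≤ L) (v : V) :
    (phaseStart G β L R key i v).1 ≠ ⊤ := by
  induction i generalizing v with
  | zero => exact proposal_ne_top hβ _ _ _
  | succ i ih => exact phaseStart_succ_ne_top hG hβ hM hM' hML hi (ih (by omega)) (Or.inl hR) v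

/-- If the last three digits of all keys are zero and the others distinguish all keys, then a
single vertex without alarm at the end witnesses that there is no alarm at all. -/
theorem phaseStart_ne_top_of_exists (hG : G.Connected) (hβ : 0 < β)
    (hM : ∀ v, key v ≤ M) (hM' : ∃ v, key v = M) (hML : M < β ^ L) (hL : 3 ≤ L)
    (hinj : Function.Injective fun v => key v / β ^ 3) (hdvd : β ^ 3 ∣ M) {v : V}
    (hv : (phaseStart G β L R key L v).1 ≠ ⊤) (w : V) :
    (phaseStart G β L R key L w).1 ≠ ⊤ := by
  obtain ⟨l, rfl⟩ := Nat.exists_eq_add_of_le' hL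
  have hsub : l + 3 - l = 3 := by omega
  have hkey : ∀ v, key v < β ^ (l + 3) := fun v => (hM v).trans_lt hML
  -- Three phases carry an alarm `3 * (R + 1)` hops, which covers the radius `3 * R + 1`.
  have hball : ∀ w, G.dist v w ≤ 3 * R + 1 → (phaseStart G β (l + 3) R key l w).1 ≠ ⊤ :=
    fun w hw => phaseStart_ne_top_of_dist_le hG hβ hv (by rw [SimpleGraph.dist_comm]; omega)
  have hd := dist_le_of_ball hG hβ hkey (by omega) (by rwa [hsub]) hball
  have hall : ∀ w, (phaseStart G β (l + 3) R key l w).1 ≠ ⊤ :=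
    fun w => hball w ((hd w).trans (by omega))
  have hstep : ∀ k ≤ 3, ∀ w, (phaseStart G β (l + 3) R key (l + k) w).1 ≠ ⊤ := by
    intro k
    induction k with
    | zero => exact fun _ => hall
    | succ k ih =>
      intro hk
      exact phaseStart_succ_ne_top hG hβ hM hM' hML (i := l + k) (by omega) (ih (by omega))
        (Or.inr (digit_eq_zero_of_dvd hβ (l := l) (i := l + k) (by omega) (by omega) (by rwa [hsub])))
  exact hstep 3 le_rfl w

end Attempt

/-! ### The algorithm -/

/-- Local states of the algorithm. Stage `stage` consists of `L` phases; a phase takes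
`2 ^ stage + 1` rounds. -/
structure AgreementState (β : ℕ) where
  stage : ℕ
  phase : ℕ
  step : ℕ
  acc : ℕ
  key : ℕ
  value : Fin (β + 1)
  output : Option ℕ

/-- In each stage, the vertices try to agree on the digits of the largest key. After a stage with
an alarm they start all over with twice the radius. The key is composed of the input, the
identifier (less than `W`) and three zeros. -/
noncomputable def agreement (β L W : ℕ) : MaxProgram β where
  State := AgreementState β
  initial id x := ⟨0, 0, 0, 0, (x * W + id) * β ^ 3,
    proposal β L ((x * W + id) * β ^ 3) 0 0, none⟩
  value σ := σ.value
  update σ y :=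
    if σ.step < 2 ^ σ.stage then
      ⟨σ.stage, σ.phase, σ.step + 1, σ.acc, σ.key, max σ.value y, σ.output⟩
    -- In the last round of a phase `σ.value` is the maximum within `R = 2 ^ σ.stage`, and the word
    -- just heard extends it to `R + 1`, so both arguments of `advance` are available.
    else if σ.phase + 1 < L then
      ⟨σ.stage, σ.phase + 1, 0,
        (advance β L σ.key σ.phase σ.value (max σ.value y) σ.acc).2, σ.key,
        (advance β L σ.key σ.phase σ.value (max σ.value y) σ.acc).1, σ.output⟩
    else if (advance β L σ.key σ.phase σ.value (max σ.value y) σ.acc).1 = ⊤ then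
      ⟨σ.stage + 1, 0, 0, 0, σ.key, proposal β L σ.key 0 0, σ.output⟩
    else
      -- Dividing by `β ^ 3` removes the zeros, and dividing by `W` removes the identifier.
      ⟨σ.stage, σ.phase, σ.step, σ.acc, σ.key, σ.value,
        some ((advance β L σ.key σ.phase σ.value (max σ.value y) σ.acc).2 / β ^ 3 / W)⟩
  output σ := σ.output

/-! ### Execution in stages with doubling radius -/

section Run

variable {V : Type*} [Fintype V] (G : SimpleGraph V) [DecidableRel G.Adj] (β L W : ℕ)
  (key : V → ℕ)

/-- The configuration before round `r` of phase `i` of stage `j`. -/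
noncomputable def configuration (j i r : ℕ) : V → (agreement β L W).State := fun v =>
  ⟨j, i, r, (phaseStart G β L (2 ^ j) key i v).2, key v,
    (flood G)^[r] (fun u => (phaseStart G β L (2 ^ j) key i u).1) v, none⟩

variable {G β L W key}

theorem configuration_flood (j i : ℕ) {r : ℕ} (hr : r ≤ 2 ^ j) :
    (agreement β L W).Reaches G r (configuration G β L W key j i 0)
      (configuration G β L W key j i r) := by
  induction r with
  | zero => exact .refl _
  | succ r ih =>
    refine (ih (by omega)).trans (.single (fun _ => rfl) ?_)
    funext v
    simp only [MaxProgram.round, agreement, configuration]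
    rw [if_pos (by omega), Function.iterate_succ_apply']
    rfl

theorem round_configuration_of_lt (j : ℕ) {i : ℕ} (hi : i + 1 < L) :
    (agreement β L W).round G (configuration G β L W key j i (2 ^ j)) =
      configuration G β L W key j (i + 1) 0 := by
  funext v
  simp only [MaxProgram.round, agreement, configuration, lt_self_iff_false, if_false, if_pos hi]
  simp only [phaseStart, Function.iterate_succ_apply', Function.iterate_zero_apply]
  rfl

theorem round_configuration_of_eq_top (j i : ℕ) (hi : i + 1 = L) {v : V}
    (hv : (phaseStart G β L (2 ^ j) key L v).1 = ⊤) :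
    (agreement β L W).round G (configuration G β L W key j i (2 ^ j)) v =
      configuration G β L W key (j + 1) 0 0 v := by
  subst hi
  rw [phaseStart, Function.iterate_succ_apply'] at hv
  simp only [MaxProgram.round, agreement, configuration, lt_self_iff_false, if_false]
  exact if_pos hv

theorem output_round_configuration (j i : ℕ) (hi : i + 1 = L) {v : V}
    (hv : (phaseStart G β L (2 ^ j) key L v).1 ≠ ⊤) :
    (agreement β L W).output
        ((agreement β L W).round G (configuration G β L W key j i (2 ^ j)) v) =
      some ((phaseStart G β L (2 ^ j) key L v).2 / β ^ 3 / W) := by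
  subst hi
  rw [phaseStart, Function.iterate_succ_apply'] at hv ⊢
  simp only [MaxProgram.round, agreement, configuration, lt_self_iff_false, if_false]
  exact congrArg AgreementState.output (if_neg hv)

theorem configuration_phase (j : ℕ) {i : ℕ} (hi : i < L) :
    (agreement β L W).Reaches G (i * (2 ^ j + 1)) (configuration G β L W key j 0 0)
      (configuration G β L W key j i 0) := by
  induction i with
  | zero => simpa using MaxProgram.Reaches.refl _
  | succ i ih =>
    rw [Nat.succ_mul, ← add_assoc]
    exact ((ih (by omega)).trans (configuration_flood j i le_rfl)).trans
      (.single (fun _ => rfl) (round_configuration_of_lt j hi))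

theorem configuration_stage (hL : 0 < L) (j : ℕ) :
    (agreement β L W).Reaches G (L * (2 ^ j + 1)) (configuration G β L W key j 0 0)
      ((agreement β L W).round G (configuration G β L W key j (L - 1) (2 ^ j))) := by
  obtain ⟨l, rfl⟩ := Nat.exists_eq_add_of_le' hL
  rw [Nat.succ_mul, ← add_assoc]
  exact ((configuration_phase j (Nat.lt_succ_self l)).trans
    (configuration_flood j l le_rfl)).trans (.single (fun _ => rfl) rfl)

/-- The deterministic execution ends with the same correct output everywhere once the radius
exceeds the diameter, or earlier. -/
theorem exists_reaches_output (hG : G.Connected) (hβ : 0 < β) {M : ℕ}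
    (hM : ∀ v, key v ≤ M) (hM' : ∃ v, key v = M) (hML : M < β ^ L) (hL : 3 ≤ L)
    (hinj : Function.Injective fun v => key v / β ^ 3) (hdvd : β ^ 3 ∣ M) {J : ℕ}
    (hJ : ∀ u v, G.dist u v ≤ 2 ^ J) {j : ℕ} (hj : j ≤ J) :
    ∃ t τ, t + 2 * L * 2 ^ j ≤ 4 * L * 2 ^ J ∧
      (agreement β L W).Reaches G t (configuration G β L W key j 0 0) τ ∧
      ∀ v, (agreement β L W).output (τ v) = some (M / β ^ 3 / W) := by
  have hacc := fun j => phaseStart_snd_eq_of_forall_ne_top (R := 2 ^ j) hG hβ hM hM' hML le_rfl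
  have hstage : ∀ j, (∀ v, (phaseStart G β L (2 ^ j) key L v).1 ≠ ⊤) → ∀ v,
      (agreement β L W).output ((agreement β L W).round G
        (configuration G β L W key j (L - 1) (2 ^ j)) v) = some (M / β ^ 3 / W) := by
    intro j hok v
    rw [output_round_configuration j (L - 1) (by omega) (hok v), hacc j hok v]
    simp
  -- Stage `j` takes `L * (2 ^ j + 1) ≤ 2 * L * 2 ^ j` rounds. The summand `2 * L * 2 ^ j` in the
  -- bound doubles with `j` and pays for the stage.
  induction hj using Nat.decreasingInduction with
  | self =>
    refine ⟨_, _, ?_, configuration_stage (by omega) J, hstage J fun v =>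
      phaseStart_ne_top_of_dist_le_radius hG hβ hM hM' hML hJ le_rfl v⟩
    have := Nat.one_le_two_pow (n := J)
    nlinarith
  | of_succ j hj ih =>
    have hpow : 2 ^ (j + 1) ≤ 2 ^ J := Nat.pow_le_pow_right (by norm_num) hj
    have hone := Nat.one_le_two_pow (n := j)
    by_cases hok : ∀ v, (phaseStart G β L (2 ^ j) key L v).1 ≠ ⊤
    · refine ⟨_, _, ?_, configuration_stage (by omega) j, hstage j hok⟩
      rw [pow_succ] at hpow
      nlinarith
    · obtain ⟨t, τ, ht, hr, ho⟩ := ih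
      refine ⟨L * (2 ^ j + 1) + t, τ, ?_,
        (configuration_stage (by omega) j).trans (Eq.subst (motive := fun σ =>
          (agreement β L W).Reaches G t σ τ) ?_ hr), ho⟩
      · rw [pow_succ] at ht
        nlinarith
      · funext v
        refine (round_configuration_of_eq_top j (L - 1) (by omega) ?_).symm
        -- One vertex without alarm would mean no alarm anywhere, so in a failed stage every vertex
        -- has an alarm and all restart in the same round.
        by_contra hv
        exact hok fun w => phaseStart_ne_top_of_exists hG hβ hM hM' hML hL hinj hdvd hv w

/-- On a connected network of positive diameter, the deterministic execution outputs the maximum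
input within `8 * L * diam` rounds. -/
theorem exists_reaches_sup (hG : G.Connected) (hdiam : 1 ≤ G.diam) (hβ : 0 < β) (hL : 3 ≤ L)
    {ident x : V → ℕ} (hinj : Function.Injective ident) (hW : ∀ v, ident v < W)
    (hbound : ∀ v, x v * W + ident v < β ^ (L - 3)) :
    ∃ t τ, t ≤ 8 * L * G.diam ∧
      (agreement β L W).Reaches G t
        (fun v => (agreement β L W).initial (ident v) (x v)) τ ∧
      ∀ v, (agreement β L W).output (τ v) = some (Finset.univ.sup x) := by
  have := hG.nonempty
  obtain ⟨m, -, hm⟩ := Finset.exists_mem_eq_sup Finset.univ Finset.univ_nonempty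
    (fun v => (x v * W + ident v) * β ^ 3)
  have hmax : ∀ v, (x v * W + ident v) * β ^ 3 ≤ (x m * W + ident m) * β ^ 3 := fun v =>
    hm ▸ Finset.le_sup (f := fun v => (x v * W + ident v) * β ^ 3) (Finset.mem_univ v)
  have hW0 : 0 < W := (Nat.zero_le _).trans_lt (hW m)
  have hdiv : ∀ v, (x v * W + ident v) * β ^ 3 / β ^ 3 / W = x v := fun v => by
    rw [Nat.mul_div_cancel _ (pow_pos hβ 3), mul_comm, Nat.mul_add_div hW0,
      Nat.div_eq_of_lt (hW v), add_zero]
  have hsup : Finset.univ.sup x = (x m * W + ident m) * β ^ 3 / β ^ 3 / W := by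
    refine le_antisymm (Finset.sup_le fun v _ => ?_) ?_
    · rw [← hdiv v]
      exact Nat.div_le_div_right (Nat.div_le_div_right (hmax v))
    · rw [hdiv]
      exact Finset.le_sup (Finset.mem_univ m)
  have hpow : G.diam ≤ 2 ^ Nat.clog 2 G.diam := Nat.le_pow_clog (by norm_num) _
  -- Rounding the diameter up to a power of two costs a factor `2`, which turns `4 * L * 2 ^ J` into
  -- `8 * L * G.diam`.
  have hpow' : 2 ^ Nat.clog 2 G.diam ≤ 2 * G.diam := by
    rcases hdiam.eq_or_lt with h | h
    · simp [← h]
    · have := Nat.pow_pred_clog_lt_self (b := 2) (by norm_num) h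
      have hpos := Nat.clog_pos (b := 2) (by norm_num) h
      rw [← Nat.succ_pred_eq_of_pos hpos, pow_succ]
      omega
  have hdist : ∀ u v, G.dist u v ≤ 2 ^ Nat.clog 2 G.diam := fun u v =>
    (SimpleGraph.dist_le_diam (SimpleGraph.connected_iff_ediam_ne_top.1 hG)).trans hpow
  obtain ⟨t, τ, ht, hr, ho⟩ := exists_reaches_output (W := W)
    (key := fun v => (x v * W + ident v) * β ^ 3) hG hβ hmax ⟨m, rfl⟩
    (by
      rw [show L = L - 3 + 3 by omega, pow_add]
      exact Nat.mul_lt_mul_of_pos_right (hbound m) (pow_pos hβ 3)) hL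
    (by
      intro u v huv
      dsimp only at huv
      rw [Nat.mul_div_cancel _ (pow_pos hβ 3), Nat.mul_div_cancel _ (pow_pos hβ 3)] at huv
      apply hinj
      have := congrArg (· % W) huv
      simpa [Nat.mul_add_mod', Nat.mod_eq_of_lt (hW _)] using this)
    (Dvd.intro_left _ rfl) hdist (Nat.zero_le _)
  refine ⟨t, τ, ?_, hr, fun v => by rw [ho, hsup]⟩
  nlinarith

end Run

theorem diam_lt_card {V : Type*} [Fintype V] {G : SimpleGraph V} (hG : G.Connected) :
    G.diam < Fintype.card V := by
  have := hG.nonempty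
  obtain ⟨u, v, h⟩ := G.exists_dist_eq_diam
  obtain ⟨p, hp, hl⟩ := hG.exists_path_of_dist u v
  rw [← h, ← hl]
  exact hp.length_lt

/-! ### Parameters -/

/-- Number of phases of a stage. -/
def phases (e N : ℕ) : ℕ := Nat.clog (Nat.log 2 N + 2) (N ^ e) + 3

theorem log_le_natLog_add_one (N : ℕ) : Real.log N ≤ Nat.log 2 N + 1 := by
  rcases Nat.eq_zero_or_pos N with rfl | hN
  · simp
  have h1 : (N : ℝ) ≤ 2 ^ (Nat.log 2 N + 1) := by
    exact_mod_cast (Nat.lt_pow_succ_log_self (by norm_num) N).le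
  have h2 := Real.log_le_log (by positivity) h1
  rw [Real.log_pow] at h2
  have h3 : Real.log 2 ≤ 1 := by linarith [Real.log_two_lt_d9]
  push_cast at h2
  nlinarith [Nat.cast_nonneg (α := ℝ) (Nat.log 2 N)]

theorem natLog_mul_log_two_le {N : ℕ} (hN : N ≠ 0) : Nat.log 2 N * Real.log 2 ≤ Real.log N := by
  rw [← Real.log_pow]
  exact Real.log_le_log (by positivity) (by exact_mod_cast Nat.pow_log_le_self 2 hN)

theorem one_le_log_div_log_log {n : ℕ} (hn : 3 ≤ n) :
    0 < Real.log (Real.log n) ∧ 1 ≤ Real.log n / Real.log (Real.log n) := by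
  have h3 : (3 : ℝ) ≤ n := by exact_mod_cast hn
  have h1 : 1 < Real.log n := by
    rw [Real.lt_log_iff_exp_lt (by linarith)]
    linarith [Real.exp_one_lt_d9]
  have h2 := Real.log_pos h1
  refine ⟨h2, (one_le_div h2).2 ?_⟩
  linarith [Real.log_le_sub_one_of_pos (show 0 < Real.log n by linarith)]

/-- The base is at least `log n`, and `log N ≤ b * log n`. The `4` consists of the three zero digits
and the rounding of the logarithm, absorbed because the ratio is at least `1`. -/
theorem phases_le (e b : ℕ) {n N : ℕ} (hn : 3 ≤ n) (hnN : n ≤ N) (hN : N ≤ n ^ b) :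
    (phases e N : ℝ) ≤ (e * b + 4) * (Real.log n / Real.log (Real.log n)) := by
  obtain ⟨hll, h1⟩ := one_le_log_div_log_log hn
  have hn0 : (0 : ℝ) < n := by positivity
  have hN0 : (0 : ℝ) < N := by exact_mod_cast (by omega : 0 < N)
  have hlogn : 0 < Real.log n := Real.log_pos (by exact_mod_cast (by omega : 1 < n))
  have hlogN : Real.log n ≤ Real.log N := Real.log_le_log hn0 (by exact_mod_cast hnN)
  have hlogN' : Real.log N ≤ b * Real.log n := by
    rw [← Real.log_pow]
    exact Real.log_le_log hN0 (by exact_mod_cast hN)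
  have hbase : Real.log (Real.log n) ≤ Real.log ((Nat.log 2 N + 2 : ℕ) : ℝ) := by
    refine Real.log_le_log hlogn ?_
    push_cast
    linarith [log_le_natLog_add_one N]
  have hclog : (Nat.clog (Nat.log 2 N + 2) (N ^ e) : ℝ) ≤
      e * Real.log N / Real.log ((Nat.log 2 N + 2 : ℕ) : ℝ) + 1 := by
    rw [← Real.natCeil_logb_natCast]
    have hlogb : Real.logb ((Nat.log 2 N + 2 : ℕ) : ℝ) ((N ^ e : ℕ) : ℝ) =
        e * Real.log N / Real.log ((Nat.log 2 N + 2 : ℕ) : ℝ) := by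
      rw [Real.logb, Nat.cast_pow, Real.log_pow]
    rw [hlogb]
    exact (Nat.ceil_lt_add_one (div_nonneg (by nlinarith [Nat.cast_nonneg (α := ℝ) e])
      (hll.le.trans hbase))).le
  have hdiv : e * Real.log N / Real.log ((Nat.log 2 N + 2 : ℕ) : ℝ) ≤
      e * (b * Real.log n) / Real.log (Real.log n) := by
    gcongr
  have heq : e * (b * Real.log n) / Real.log (Real.log n) =
      e * b * (Real.log n / Real.log (Real.log n)) := by ring
  rw [phases]
  push_cast
  nlinarith

theorem bits_le (e : ℕ) {N : ℕ} (hN : 2 ≤ N) :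
    (((Nat.log 2 N + 2 + 1) * (e * (Nat.log 2 N + 1)) : ℕ) : ℝ) ≤
      8 * e / Real.log 2 ^ 2 * Real.log N ^ 2 := by
  have h2 : 0 < Real.log 2 := Real.log_pos (by norm_num)
  have h1 : Real.log 2 ≤ Real.log N :=
    Real.log_le_log (by norm_num) (by exact_mod_cast hN)
  have h3 := natLog_mul_log_two_le (N := N) (by omega)
  have h4 : (Nat.log 2 N : ℝ) ≤ Real.log N / Real.log 2 := (le_div_iff₀ h2).2 h3
  have h5 : 1 ≤ Real.log N / Real.log 2 := (one_le_div h2).2 h1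
  have h6 : (((Nat.log 2 N + 2 + 1) * (e * (Nat.log 2 N + 1)) : ℕ) : ℝ) ≤
      (4 * (Real.log N / Real.log 2)) * (e * (2 * (Real.log N / Real.log 2))) := by
    push_cast
    gcongr <;> linarith
  refine h6.trans (le_of_eq ?_)
  field_simp
  ring

/-- Since `T ≤ 32 * N ^ (e + 1)` and `32 ≤ N ^ 4`, the product with `n ^ 2 * n ^ c` is at most `N ^
(e + c + 7)`, so the exponent `e + c + 8` leaves one to spare. -/
theorem failure_le {e c n N T : ℕ} (hn : 3 ≤ n) (hnN : n ≤ N) (hT : T ≤ 8 * phases e N * n) :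
    (T * n ^ 2 : ℝ) / 2 ^ ((e + c + 8) * (Nat.log 2 N + 1)) ≤ 1 / (n : ℝ) ^ c := by
  have hphases : phases e N ≤ 4 * N ^ e := by
    have h1 : Nat.clog (Nat.log 2 N + 2) (N ^ e) ≤ N ^ e :=
      Nat.clog_le_of_le_pow (Nat.lt_pow_self (by omega)).le
    have h2 : 0 < N ^ e := pow_pos (by omega) e
    rw [phases]
    omega
  have h8 : 32 ≤ N ^ 4 := (by norm_num : 32 ≤ 3 ^ 4).trans (Nat.pow_le_pow_left (by omega) 4)
  have hpow : N ^ (e + c + 8) ≤ 2 ^ ((e + c + 8) * (Nat.log 2 N + 1)) := by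
    rw [mul_comm, pow_mul]
    exact Nat.pow_le_pow_left (Nat.lt_pow_succ_log_self (by norm_num) N).le _
  have key : T * n ^ 2 * n ^ c ≤ 2 ^ ((e + c + 8) * (Nat.log 2 N + 1)) := by
    calc T * n ^ 2 * n ^ c ≤ (8 * (4 * N ^ e) * N) * N ^ 2 * N ^ c := by
          refine Nat.mul_le_mul (Nat.mul_le_mul (hT.trans ?_) ?_) ?_
          · exact Nat.mul_le_mul (Nat.mul_le_mul_left 8 hphases) hnN
          · exact Nat.pow_le_pow_left hnN 2
          · exact Nat.pow_le_pow_left hnN c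
      _ = 32 * N ^ (e + c + 3) := by ring
      _ ≤ N ^ 4 * N ^ (e + c + 3) := Nat.mul_le_mul_right _ h8
      _ ≤ N ^ (e + c + 8) := by
          rw [← pow_add]
          exact Nat.pow_le_pow_right (by omega) (by omega)
      _ ≤ _ := hpow
  have hn0 : (0 : ℝ) < (n : ℝ) ^ c := by positivity
  rw [div_le_div_iff₀ (by positivity) hn0, one_mul]
  exact_mod_cast key

end AdditiveNetwork

/-! ### The main theorem -/

theorem mainTheorem2 :
    ∃ p : ℕ, ∀ a b k c : ℕ,
      ∃ (A : ℕ → AdditiveNetwork.Protocol) (K C : ℝ),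
        (∀ N : ℕ, 2 ≤ N → ((A N).bits : ℝ) ≤ K * Real.log N ^ p) ∧
        ∀ (V : Type*) [Fintype V] (G : SimpleGraph V) [DecidableRel G.Adj] (n N : ℕ)
          (ident x : V → ℕ),
          G.Connected → Fintype.card V = n → 3 ≤ n → n ≤ N → N ≤ n ^ b →
          Function.Injective ident → (∀ v, 1 ≤ ident v ∧ ident v ≤ n ^ a) →
          (∀ v, 1 ≤ x v ∧ x v ≤ n ^ k) →
          1 - 1 / (n : ℝ) ^ c ≤
            ((A N).coinLaw V).real
              {ω | (A N).ComputesWithin G ident x ω (Finset.univ.sup x)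
                (C * (G.diam * (Real.log n / Real.log (Real.log n))))} := by
  open AdditiveNetwork in
  -- The exponent `2` counts two factors of order `log N`: the number of blocks and the coins per
  -- block. `W = N ^ a + 1` exceeds all identifiers, and without its zeros a key is below `N ^ (k +
  -- a + 2)`, which fixes the number of digits.
  refine ⟨2, fun a b k c => ⟨fun N =>
    (agreement (Nat.log 2 N + 2) (phases (k + a + 2) N) (N ^ a + 1)).toProtocol
      ((k + a + 2 + c + 8) * (Nat.log 2 N + 1)),
    8 * (k + a + 2 + c + 8 : ℕ) / Real.log 2 ^ 2, 8 * ((k + a + 2 : ℕ) * b + 4),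
    fun N hN => bits_le _ hN, ?_⟩⟩
  intro V _ G _ n N ident x hG hcard hn hnN hNb hinj hid hx
  have hdiam : 1 ≤ G.diam := by
    have : Nontrivial V := Fintype.one_lt_card_iff_nontrivial.1 (by omega)
    exact Nat.one_le_iff_ne_zero.2 (SimpleGraph.connected_iff_diam_ne_zero.1 hG)
  have hW : ∀ v, ident v < N ^ a + 1 := fun v =>
    Nat.lt_succ_of_le ((hid v).2.trans (Nat.pow_le_pow_left hnN a))
  have hbound : ∀ v, x v * (N ^ a + 1) + ident v <
      (Nat.log 2 N + 2) ^ (phases (k + a + 2) N - 3) := by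
    intro v
    have h1 : N ^ (k + a + 2) ≤ (Nat.log 2 N + 2) ^ (phases (k + a + 2) N - 3) :=
      Nat.le_pow_clog (by omega) _
    have h2 : x v ≤ N ^ k := (hx v).2.trans (Nat.pow_le_pow_left hnN k)
    have h3 : N ^ k + 1 ≤ N ^ (k + 1) := by
      have := pow_pos (show 0 < N by omega) k
      rw [pow_succ]; nlinarith
    have h4 : N ^ a + 1 ≤ N ^ (a + 1) := by
      have := pow_pos (show 0 < N by omega) a
      rw [pow_succ]; nlinarith
    refine lt_of_lt_of_le ?_ h1
    calc x v * (N ^ a + 1) + ident v < (x v + 1) * (N ^ a + 1) := by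
          have := hW v; rw [Nat.succ_mul]; omega
      _ ≤ N ^ (k + 1) * N ^ (a + 1) := Nat.mul_le_mul (by omega) h4
      _ = N ^ (k + a + 2) := by ring
  obtain ⟨t, τ, ht, hr, ho⟩ := exists_reaches_sup hG hdiam (by omega)
    (show 3 ≤ phases (k + a + 2) N from Nat.le_add_left _ _) hinj hW hbound
  have htn : t ≤ 8 * phases (k + a + 2) N * n :=
    ht.trans (Nat.mul_le_mul_left _ (hcard ▸ (diam_lt_card hG).le))
  have hfail := failure_le (c := c) hn hnN htn
  have hprob := MaxProgram.le_coinLaw_stateAfter_eq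
    ((k + a + 2 + c + 8) * (Nat.log 2 N + 1)) ident x t hr.2
  rw [hcard, hr.1] at hprob
  refine (sub_le_sub_left hfail 1).trans (hprob.trans (MeasureTheory.measureReal_mono ?_))
  intro ω hω
  refine ⟨t, ?_, fun v => ?_⟩
  · have h1 := phases_le (k + a + 2) b hn hnN hNb
    have h2 : (t : ℝ) ≤ 8 * phases (k + a + 2) N * G.diam := by exact_mod_cast ht
    have h3 : (0 : ℝ) ≤ G.diam := Nat.cast_nonneg _
    calc (t : ℝ) ≤ 8 * phases (k + a + 2) N * G.diam := h2
      _ ≤ 8 * (((k + a + 2 : ℕ) * b + 4) * (Real.log n / Real.log (Real.log n))) * G.diam := by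
          gcongr
      _ = _ := by ring
  · exact (congrArg _ (congrFun hω v)).trans (ho v)
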